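/- Let $X_1, X_2, \ldots$ be i.i.d. random variables taking values in a measurable space $\mathcal{X}$, let $\Theta$ be a measurable space, let $f : \Theta \times \mathcal{X} \to [0,1]$ be a measurable function, let $P_0$ be a probability measure on $\Theta$ (the prior, which does not depend on the sample), and let $\delta \in (0,1]$. For $\theta \in \Theta$ and $n \ge 1$ put $\mu_\theta := \mathbb{E}[f(\theta, X_1)]$ and $\hat\mu_\theta := \frac1n \sum_{i=1}^n f(\theta, X_i)$. For $p, q \in [0,1]$ let $$\mathsf{kl}(p,q) := p \ln\frac{p}{q} + (1-p) \ln\frac{1-p}{1-q} \in [0,\infty]$$ be the Kullback–Leibler divergence between the Bernoulli distributions with parameters $p$ and $q$, with the conventions $0 \ln \frac{0}{q} = 0$ and $p \ln \frac{p}{0} = \infty$ for $p > 0$. A data-dependent distribution for sample size $n$ is a probability kernel $P$ from $\mathcal{X}^n$ to $\Theta$, and we write $P_n := P(X_1, \ldots, X_n)$. Put $$\mathcal{C}_n := \mathsf{KL}(P_n \,\|\, P_0) + \ln \frac{\sqrt{\pi}\, \Gamma(n+1)}{\Gamma(n+\frac12)},$$ where $\mathsf{KL}(P_n \,\|\, P_0)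 := \int \ln \frac{\mathrm{d}P_n}{\mathrm{d}P_0}\, \mathrm{d}P_n$ if $P_n \ll P_0$ and $\mathsf{KL}(P_n \,\|\, P_0) := \infty$ otherwise. Then, with probability at least $1-\delta$, simultaneously for all integers $n \ge 1$ and all data-dependent distributions $P_n$, $$\mathsf{kl}\Big(\int \hat\mu_\theta \,\mathrm{d}P_n(\theta),\ \int \mu_\theta \,\mathrm{d}P_n(\theta)\Big) \le \frac{\mathcal{C}_n + \ln\frac1\delta}{n}.$$ -/

import Mathlib

open MeasureTheory ProbabilityTheory InformationTheory

namespace PACBayes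

/-- The term `p ln (p / q)`, for `p, q ∈ [0, 1]`, with the usual conventions
`0 ln (0 / q) = 0` and `p ln (p / 0) = ∞` for `p > 0`. -/
noncomputable def klTerm (p q : ℝ) : EReal :=
  if p = 0 then 0 else if q = 0 then ⊤ else ((p * Real.log (p / q) : ℝ) : EReal)

/-- The Kullback-Leibler divergence between the Bernoulli distributions with parameters
`p, q ∈ [0, 1]`, namely `p ln (p / q) + (1 - p) ln ((1 - p) / (1 - q))`, with values in
`[0, ∞]`. -/
noncomputable def bernoulliKL (p q : ℝ) : EReal :=
  klTerm p q + klTerm (1 - p) (1 - q)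

/-- The empirical mean `(1 / n) ∑ f (θ, xᵢ)` of a sample `x` of size `n`. -/
noncomputable def empiricalMean {Θ 𝒳 : Type*} (f : Θ → 𝒳 → ℝ) {n : ℕ} (x : Fin n → 𝒳)
    (θ : Θ) : ℝ :=
  (∑ i, f θ (x i)) / n

/-- The mean `𝔼 [f (θ, Y)]` for a random element `Y`. -/
noncomputable def trueMean {Θ 𝒳 Ω : Type*} [MeasurableSpace Ω] (f : Θ → 𝒳 → ℝ)
    (P : Measure Ω) (Y : Ω → 𝒳) (θ : Θ) : ℝ :=
  ∫ ω, f θ (Y ω) ∂P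

/-- The complexity `KL (Q ‖ P₀) + ln (√π Γ(n + 1) / Γ(n + 1 / 2))` of a posterior `Q` relative to
a prior `P₀`, with values in `[0, ∞]`. -/
noncomputable def complexity {Θ : Type*} [MeasurableSpace Θ] (n : ℕ) (Q P₀ : Measure Θ) : EReal :=
  (klDiv Q P₀ : EReal) +
    ((Real.log (√Real.pi * Real.Gamma ((n : ℝ) + 1) / Real.Gamma ((n : ℝ) + 1 / 2)) : ℝ) : EReal)

end PACBayes

/-! For fixed `θ` and `q`, the factors `x q / μ_θ + (1 - x) (1 - q) / (1 - μ_θ)` at `x = f θ (X i)`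
are independent with mean at most one, so their products form a nonnegative supermartingale. Neither
`P₀` nor the Jeffreys law Beta(1/2, 1/2) sees the sample, so mixing over `θ ∼ P₀` and `q ∼ Beta(1/2,
1/2)` preserves this. By Ville's inequality (`measure_exists_le_mixture_le`) the mixture stays below
`1 / δ` for all `n` at once, outside an event of probability at most `δ`.

The rest is deterministic, hence uniform over posteriors. Weighted AM-GM bounds the product below by
`(q / μ_θ) ^ a ((1 - q) / (1 - μ_θ)) ^ b`, where `a` is the sum of the observations and `b = n - a`.
Its integral over `q` is a Beta function, and `log_Gamma_half_add_le` bounds it below by `exp (n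
kl)` times `Γ(n + 1/2) / (√π Γ(n + 1))`. The Donsker-Varadhan inequality
(`integral_le_toReal_klDiv_add_log`) then passes from `P₀` to the posterior at the price of the
divergence, and joint convexity of `kl`, through tangent planes, moves the integral inside `kl`
(`bernoulliKL_integral_le`). -/

open scoped ENNReal

namespace PACBayes

/-! ### An inequality for the Gamma function at real arguments. -/

/-- A function concave on `[0, ∞)` satisfies `h 0 + h (a + b) ≤ h a + h b`. -/
lemma _root_.ConcaveOn.zero_add_le {h : ℝ → ℝ} (hh : ConcaveOn ℝ (Set.Ici 0) h) {a b : ℝ}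
    (ha : 0 ≤ a) (hb : 0 ≤ b) : h 0 + h (a + b) ≤ h a + h b := by
  rcases (add_nonneg ha hb).eq_or_lt with h0 | h0
  · obtain rfl : a = 0 := by linarith
    obtain rfl : b = 0 := by linarith
    simp
  have hs : a / (a + b) + b / (a + b) = 1 := by field_simp
  have hs' : b / (a + b) + a / (a + b) = 1 := by field_simp; ring
  -- Both `a` and `b` are convex combinations of `a + b` and `0`, with the two weights swapped.
  have h1 := hh.2 (x := a + b) (y := 0) h0.le (le_refl (0 : ℝ)) (div_nonneg ha h0.le)
    (div_nonneg hb h0.le) hs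
  have h2 := hh.2 (x := a + b) (y := 0) h0.le (le_refl (0 : ℝ)) (div_nonneg hb h0.le)
    (div_nonneg ha h0.le) hs'
  have e1 : a / (a + b) * (a + b) = a := by field_simp
  have e2 : b / (a + b) * (a + b) = b := by field_simp
  simp only [smul_eq_mul, mul_zero, add_zero, e1, e2] at h1 h2
  have : h 0 + h (a + b) = (a / (a + b) + b / (a + b)) * h 0
      + (a / (a + b) + b / (a + b)) * h (a + b) := by rw [hs]; ring
  nlinarith

/-- The second derivative is nonpositive because `(s + j) (s + j + 1) = (s + j + 1/2) ^ 2 - 1/4`. -/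
lemma concaveOn_mul_log_sub_mul_log_sub_log {j : ℝ} (hj : 0 ≤ j) :
    ConcaveOn ℝ (Set.Ici 0) fun s : ℝ =>
      (s + j + 1) * Real.log (s + j + 1) - (s + j) * Real.log (s + j)
        - Real.log (s + j + 1 / 2) := by
  have hc : Continuous fun s : ℝ => s * Real.log s := Real.continuous_mul_log
  apply concaveOn_of_hasDerivWithinAt2_nonpos (convex_Ici 0)
    (f' := fun s => Real.log (s + j + 1) - Real.log (s + j) - 1 / (s + j + 1 / 2))
    (f'' := fun s => 1 / (s + j + 1) - 1 / (s + j) + 1 / (s + j + 1 / 2) ^ 2)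
  · refine ((Continuous.continuousOn ?_).sub (Continuous.continuousOn ?_)).sub
      (ContinuousOn.log (by fun_prop) ?_)
    · exact hc.comp (by fun_prop : Continuous fun s : ℝ => s + j + 1)
    · exact hc.comp (by fun_prop : Continuous fun s : ℝ => s + j)
    · intro s hs
      have : (0 : ℝ) ≤ s := hs
      positivity
  · intro s hs
    rw [interior_Ici] at hs
    have hs : 0 < s := hs
    apply HasDerivAt.hasDerivWithinAt
    have h1 : HasDerivAt (fun s : ℝ => s + j + 1) 1 s :=
      ((hasDerivAt_id s).add_const j).add_const 1
    have h2 : HasDerivAt (fun s : ℝ => s + j) 1 s := (hasDerivAt_id s).add_const j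
    have h3 : HasDerivAt (fun s : ℝ => s + j + 1 / 2) 1 s :=
      ((hasDerivAt_id s).add_const j).add_const _
    refine (((h1.mul (h1.log (by positivity))).sub (h2.mul (h2.log (by positivity)))).sub
      (h3.log (by positivity))).congr_deriv ?_
    have : s + j ≠ 0 := by positivity
    have : s + j + 1 ≠ 0 := by positivity
    field_simp
    ring
  · intro s hs
    rw [interior_Ici] at hs
    have hs : 0 < s := hs
    apply HasDerivAt.hasDerivWithinAt
    have h1 : HasDerivAt (fun s : ℝ => s + j + 1) 1 s :=
      ((hasDerivAt_id s).add_const j).add_const 1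
    have h2 : HasDerivAt (fun s : ℝ => s + j) 1 s := (hasDerivAt_id s).add_const j
    have h3 : HasDerivAt (fun s : ℝ => s + j + 1 / 2) 1 s :=
      ((hasDerivAt_id s).add_const j).add_const _
    refine (((h1.log (by positivity)).sub (h2.log (by positivity))).sub
      ((hasDerivAt_const s (1 : ℝ)).div h3 (by positivity))).congr_deriv ?_
    ring
  · intro s hs
    rw [interior_Ici] at hs
    have hs : 0 < s := hs
    have h1 : 0 < s + j := by positivity
    have : 1 / (s + j + 1) - 1 / (s + j) + 1 / (s + j + 1 / 2) ^ 2
        = - (1 / 4) / ((s + j + 1) * (s + j) * (s + j + 1 / 2) ^ 2) := by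
      field_simp
      ring
    rw [this]
    exact div_nonpos_of_nonpos_of_nonneg (by norm_num) (by positivity)

lemma concaveOn_neg_mul_log_add {c : ℝ} (hc : 0 ≤ c) :
    ConcaveOn ℝ (Set.Ici 0) fun s : ℝ => -((s + c) * Real.log (s + c)) := by
  have h := (Real.convexOn_mul_log.neg).translate_left c
  refine (h.subset (fun s hs => ?_) (convex_Ici 0)).congr ?_
  · have : (0 : ℝ) ≤ s := hs
    simp only [Set.mem_preimage, Set.mem_Ici]
    positivity
  · intro s _
    simp [add_comm]

/-- Telescoping `s log s` through the Bohr-Mollerup sum leaves an affine function of `s` plus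
concave terms, to each of which `ConcaveOn.zero_add_le` applies. -/
lemma logGammaSeq_sub_mul_log (s : ℝ) (n : ℕ) :
    Real.BohrMollerup.logGammaSeq (s + 1 / 2) n - s * Real.log s
      = (s + 1 / 2) * Real.log n + Real.log n.factorial
        + (∑ j ∈ Finset.range (n + 1), ((s + j + 1) * Real.log (s + j + 1)
          - (s + j) * Real.log (s + j) - Real.log (s + j + 1 / 2)))
        + -((s + (n + 1 : ℕ)) * Real.log (s + (n + 1 : ℕ))) := by
  have := Finset.sum_range_sub (fun j : ℕ => (s + j) * Real.log (s + j)) (n + 1)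
  simp only [Nat.cast_zero, add_zero] at this
  rw [Real.BohrMollerup.logGammaSeq, Finset.sum_sub_distrib]
  have e : ∑ j ∈ Finset.range (n + 1), ((s + j + 1) * Real.log (s + j + 1)
          - (s + j) * Real.log (s + j)) = (s + (n + 1 : ℕ)) * Real.log (s + (n + 1 : ℕ))
            - s * Real.log s := by
    rw [← this]
    refine Finset.sum_congr rfl fun j _ => ?_
    push_cast
    simp only [add_assoc]
  rw [e]
  have e2 : ∑ j ∈ Finset.range (n + 1), Real.log (s + 1 / 2 + j)
      = ∑ j ∈ Finset.range (n + 1), Real.log (s + j + 1 / 2) :=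
    Finset.sum_congr rfl fun j _ => by rw [add_right_comm]
  rw [e2]
  ring

/-- Logarithmic form of `√π Γ(a + b + 1/2) a ^ a b ^ b / (a + b) ^ (a + b) ≤
Γ(a + 1/2) Γ(b + 1/2)`. -/
lemma log_Gamma_half_add_le {a b : ℝ} (ha : 0 ≤ a) (hb : 0 ≤ b) :
    Real.log (Real.Gamma (1 / 2)) + (Real.log (Real.Gamma (a + b + 1 / 2))
        - (a + b) * Real.log (a + b))
      ≤ (Real.log (Real.Gamma (a + 1 / 2)) - a * Real.log a)
        + (Real.log (Real.Gamma (b + 1 / 2)) - b * Real.log b) := by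
  have t (s : ℝ) (hs : 0 ≤ s) := (Real.BohrMollerup.tendsto_log_gamma
    (show 0 < s + 1 / 2 by positivity)).sub_const (s * Real.log s)
  have t0 := t 0 le_rfl
  simp only [zero_mul, sub_zero, zero_add] at t0
  refine le_of_tendsto_of_tendsto' (t0.add (t (a + b) (add_nonneg ha hb)))
    ((t a ha).add (t b hb)) fun n => ?_
  have e0 := logGammaSeq_sub_mul_log 0 n
  rw [zero_mul, sub_zero, zero_add] at e0
  rw [e0]
  simp only [logGammaSeq_sub_mul_log]
  have hlast := (concaveOn_neg_mul_log_add (Nat.cast_nonneg (n + 1))).zero_add_le ha hb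
  have hsum := Finset.sum_le_sum fun j (_ : j ∈ Finset.range (n + 1)) =>
    (concaveOn_mul_log_sub_mul_log_sub_log (Nat.cast_nonneg j)).zero_add_le ha hb
  simp only [Finset.sum_add_distrib] at hsum
  linarith

/-! ### Ville's inequality for mixtures. -/

section

variable {Ω 𝒳 S : Type*} [MeasurableSpace Ω] [MeasurableSpace 𝒳] [MeasurableSpace S]

/-- The mixture `∫ ∏ᵢ L s xᵢ dρ(s)` of the products of `L` over the first `n` terms of `x`. -/
noncomputable def mixture (ρ : Measure S) (L : S → 𝒳 → ℝ≥0∞) (n : ℕ) (x : ℕ → 𝒳) : ℝ≥0∞ :=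
  ∫⁻ s, ∏ i ∈ Finset.range n, L s (x i) ∂ρ

lemma measurable_prod_uncurry {L : S → 𝒳 → ℝ≥0∞} (hL : Measurable (Function.uncurry L)) (n : ℕ) :
    Measurable fun z : (ℕ → 𝒳) × S => ∏ i ∈ Finset.range n, L z.2 (z.1 i) :=
  Finset.measurable_prod _ fun i _ =>
    hL.comp (measurable_snd.prodMk ((measurable_pi_apply i).comp measurable_fst))

lemma measurable_mixture (ρ : Measure S) [SFinite ρ] {L : S → 𝒳 → ℝ≥0∞}
    (hL : Measurable (Function.uncurry L)) (n : ℕ) : Measurable (mixture ρ L n) :=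
  (measurable_prod_uncurry hL n).lintegral_prod_right'

/-- Independence of a nonnegative function of the first `n` terms and one of the `n`-th term. -/
lemma lintegral_mul_le_of_iIndepFun {P : Measure Ω} {X : ℕ → Ω → 𝒳} (hX : ∀ i, Measurable (X i))
    (hindep : iIndepFun X P) {n : ℕ} {u : (Finset.range n → 𝒳) → ℝ≥0∞} (hu : Measurable u)
    {v : 𝒳 → ℝ≥0∞} (hv : Measurable v) (hv1 : ∫⁻ ω, v (X n ω) ∂P ≤ 1) :
    ∫⁻ ω, u (fun i => X i ω) * v (X n ω) ∂P ≤ ∫⁻ ω, u (fun i => X i ω) ∂P := by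
  have h := hindep.indepFun_finset (Finset.range n) {n} (by simp) hX
  have h' := h.comp hu (hv.comp (measurable_pi_apply (⟨n, by simp⟩ : ({n} : Finset ℕ))))
  have hm : Measurable fun ω => u (fun i => X i ω) :=
    hu.comp (measurable_pi_lambda _ fun i => hX i)
  have := lintegral_mul_eq_lintegral_mul_lintegral_of_indepFun'' hm.aemeasurable
    (hv.comp (hX n)).aemeasurable h'
  simp only [Function.comp_apply] at this
  rw [this]
  exact mul_le_of_le_one_right' hv1

/-- The supermartingale property of the mixtures. -/
lemma setLIntegral_mixture_succ_le {P : Measure Ω} [SFinite P] {X : ℕ → Ω → 𝒳}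
    (hX : ∀ i, Measurable (X i)) (hindep : iIndepFun X P) (ρ : Measure S) [SFinite ρ]
    {L : S → 𝒳 → ℝ≥0∞} (hL : Measurable (Function.uncurry L))
    (hL1 : ∀ᵐ s ∂ρ, ∀ i, ∫⁻ ω, L s (X i ω) ∂P ≤ 1) (n : ℕ)
    {B : Set (Finset.range n → 𝒳)} (hB : MeasurableSet B) :
    ∫⁻ ω in (fun ω (i : Finset.range n) => X i ω) ⁻¹' B,
        mixture ρ L (n + 1) (fun i => X i ω) ∂P
      ≤ ∫⁻ ω in (fun ω (i : Finset.range n) => X i ω) ⁻¹' B,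
        mixture ρ L n (fun i => X i ω) ∂P := by
  set B' := (fun ω (i : Finset.range n) => X i ω) ⁻¹' B
  have hXm : Measurable fun ω => fun i => X i ω := measurable_pi_lambda _ hX
  have hB' : MeasurableSet B' :=
    (measurable_pi_lambda (fun ω (i : Finset.range n) => X i ω) fun i => hX i) hB
  have hm (k : ℕ) : Measurable fun z : Ω × S => ∏ i ∈ Finset.range k, L z.2 (X i z.1) :=
    (measurable_prod_uncurry hL k).comp ((hXm.comp measurable_fst).prodMk measurable_snd)
  have hswap (k : ℕ) : ∫⁻ ω in B', mixture ρ L k (fun i => X i ω) ∂P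
      = ∫⁻ s, ∫⁻ ω in B', ∏ i ∈ Finset.range k, L s (X i ω) ∂P ∂ρ :=
    lintegral_lintegral_swap (hm k).aemeasurable
  rw [hswap, hswap]
  refine lintegral_mono_ae ?_
  filter_upwards [hL1] with s hs
  have hLs : Measurable (L s) := hL.comp measurable_prodMk_left
  -- With the indicator of `B` absorbed, `u` still depends on the first `n` terms only, so it is
  -- independent of the factor at `X n`.
  let u : (Finset.range n → 𝒳) → ℝ≥0∞ := B.indicator fun y => ∏ i, L s (y i)
  have hu : Measurable u := (Finset.measurable_prod _ fun i _ =>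
    hLs.comp (measurable_pi_apply i)).indicator hB
  have e (ω : Ω) : u (fun i => X i ω)
      = B'.indicator (fun ω => ∏ i ∈ Finset.range n, L s (X i ω)) ω := by
    have h : (fun i : Finset.range n => X i ω) ∈ B ↔ ω ∈ B' := Iff.rfl
    classical
    simp only [u, Set.indicator_apply, h]
    rw [← Finset.prod_coe_sort (Finset.range n) fun i => L s (X i ω)]
  have := lintegral_mul_le_of_iIndepFun hX hindep hu hLs (hs n)
  simp only [e] at this
  rw [lintegral_indicator hB'] at this
  refine le_trans (le_of_eq ?_) this
  rw [← lintegral_indicator hB']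
  refine lintegral_congr fun ω => ?_
  by_cases h : ω ∈ B' <;> simp [h, Finset.prod_range_succ]

/-- Ville's inequality for mixtures of products of independent factors with mean at most one. -/
lemma measure_exists_le_mixture_le {P : Measure Ω} [IsProbabilityMeasure P] {X : ℕ → Ω → 𝒳}
    (hX : ∀ i, Measurable (X i)) (hindep : iIndepFun X P) (ρ : Measure S) [IsProbabilityMeasure ρ]
    {L : S → 𝒳 → ℝ≥0∞} (hL : Measurable (Function.uncurry L))
    (hL1 : ∀ᵐ s ∂ρ, ∀ i, ∫⁻ ω, L s (X i ω) ∂P ≤ 1) (c : ℝ≥0∞) :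
    P {ω | ∃ n, c ≤ mixture ρ L n (fun i => X i ω)} ≤ c⁻¹ := by
  have hXm : Measurable fun ω => fun i => X i ω := measurable_pi_lambda _ hX
  have hM (n : ℕ) : Measurable fun ω => mixture ρ L n (fun i => X i ω) :=
    (measurable_mixture ρ hL n).comp hXm
  let A : ℕ → Set Ω := fun n => {ω | ∃ k ≤ n, c ≤ mixture ρ L k (fun i => X i ω)}
  have hA (n : ℕ) : MeasurableSet (A n) := by
    have : A n = ⋃ k ≤ n, {ω | c ≤ mixture ρ L k (fun i => X i ω)} := by ext; simp [A]
    rw [this]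
    exact MeasurableSet.biUnion (Set.to_countable _) fun k _ =>
      measurableSet_le measurable_const (hM k)
  have hAmono : Monotone A := fun m n hmn ω ⟨k, hk, h⟩ => ⟨k, hk.trans hmn, h⟩
  -- `A n` is the event that level `c` is reached by time `n`. The left side is a lower bound for
  -- the expectation of the process stopped on reaching `c`, which starts at the empty product `1`.
  have key (n : ℕ) :
      ∫⁻ ω in (A n)ᶜ, mixture ρ L n (fun i => X i ω) ∂P + c * P (A n) ≤ 1 := by
    have split (n : ℕ) (B : Set Ω) (hB : MeasurableSet B) (hAB : (A n)ᶜ ⊆ B)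
        (hBA : ∀ ω ∈ B ∩ A n, c ≤ mixture ρ L n (fun i => X i ω)) :
        ∫⁻ ω in (A n)ᶜ, mixture ρ L n (fun i => X i ω) ∂P + c * P (B ∩ A n)
          ≤ ∫⁻ ω in B, mixture ρ L n (fun i => X i ω) ∂P := by
      rw [← lintegral_inter_add_sdiff _ B (hA n), add_comm]
      gcongr
      · exact setLIntegral_const (B ∩ A n) c ▸
          setLIntegral_mono' (hB.inter (hA n)) hBA
      · intro ω hω
        exact ⟨hAB hω, hω⟩
    induction n with
    | zero =>
      have := split 0 Set.univ MeasurableSet.univ (Set.subset_univ _) (by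
        rintro ω ⟨-, k, hk, h⟩
        obtain rfl : k = 0 := by omega
        exact h)
      simpa [mixture] using this
    | succ n ih =>
      have hs := split (n + 1) (A n)ᶜ (hA n).compl
        (Set.compl_subset_compl.2 (hAmono n.le_succ)) (by
        rintro ω ⟨h1, k, hk, h⟩
        rcases hk.eq_or_lt with rfl | hk
        · exact h
        · exact absurd ⟨k, by omega, h⟩ h1)
      have hstep : ∫⁻ ω in (A n)ᶜ, mixture ρ L (n + 1) (fun i => X i ω) ∂P
          ≤ ∫⁻ ω in (A n)ᶜ, mixture ρ L n (fun i => X i ω) ∂P := by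
        -- Replacing the factors from index `k` on by `1` writes each mixture with `k ≤ n` as a
        -- function of the first `n` terms, so `(A n)ᶜ` is an event of the past of time `n`.
        let pm : ℕ → (Finset.range n → 𝒳) → ℝ≥0∞ := fun k y =>
          ∫⁻ s, ∏ i : Finset.range n, (if (i : ℕ) < k then L s (y i) else 1) ∂ρ
        have hpm (k : ℕ) : Measurable (pm k) := by
          refine Measurable.lintegral_prod_right' (f := fun z : (Finset.range n → 𝒳) × S =>
            ∏ i : Finset.range n, (if (i : ℕ) < k then L z.2 (z.1 i) else 1)) ?_
          refine Finset.measurable_prod _ fun i _ => ?_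
          split_ifs
          · exact hL.comp (measurable_snd.prodMk ((measurable_pi_apply i).comp measurable_fst))
          · exact measurable_const
        have hpe (k : ℕ) (hk : k ≤ n) (ω : Ω) :
            pm k (fun i => X i ω) = mixture ρ L k (fun i => X i ω) := by
          refine lintegral_congr fun s => ?_
          rw [Finset.prod_coe_sort (Finset.range n)
            (fun i => if i < k then L s (X i ω) else 1), Finset.prod_ite]
          simp only [Finset.prod_const_one, mul_one]
          refine Finset.prod_congr ?_ fun _ _ => rfl
          ext i
          simp only [Finset.mem_filter, Finset.mem_range]
          omega
        have hB : MeasurableSet (⋃ k ≤ n, {y | c ≤ pm k y})ᶜ :=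
          (MeasurableSet.biUnion (Set.to_countable _) fun k _ =>
            measurableSet_le measurable_const (hpm k)).compl
        have hBA : (fun ω (i : Finset.range n) => X i ω) ⁻¹' (⋃ k ≤ n, {y | c ≤ pm k y})ᶜ
            = (A n)ᶜ := by
          ext ω
          simp only [Set.mem_preimage, Set.mem_ofPred_eq, Set.mem_compl_iff, Set.mem_iUnion, exists_prop, A]
          refine not_congr (exists_congr fun k => and_congr_right fun hk => ?_)
          rw [hpe k hk]
        have := setLIntegral_mixture_succ_le hX hindep ρ hL hL1 n hB
        rwa [hBA] at this
      have hP : P (A (n + 1)) = P (A n) + P ((A n)ᶜ ∩ A (n + 1)) := by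
        rw [← measure_inter_add_sdiff (A (n + 1)) (hA n),
          Set.inter_eq_right.2 (hAmono n.le_succ), Set.sdiff_eq, Set.inter_comm]
      calc _ = (∫⁻ ω in (A (n + 1))ᶜ, mixture ρ L (n + 1) (fun i => X i ω) ∂P
              + c * P ((A n)ᶜ ∩ A (n + 1))) + c * P (A n) := by rw [hP]; ring
        _ ≤ ∫⁻ ω in (A n)ᶜ, mixture ρ L n (fun i => X i ω) ∂P + c * P (A n) := by
          gcongr
          exact hs.trans hstep
        _ ≤ 1 := ih
  have hU : {ω | ∃ n, c ≤ mixture ρ L n (fun i => X i ω)} = ⋃ n, A n := by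
    ext ω
    simp only [Set.mem_ofPred_eq, Set.mem_iUnion, A]
    exact ⟨fun ⟨n, h⟩ => ⟨n, n, le_rfl, h⟩, fun ⟨_, k, _, h⟩ => ⟨k, h⟩⟩
  rw [hU, hAmono.measure_iUnion]
  refine iSup_le fun n => ?_
  rw [ENNReal.le_inv_iff_mul_le, mul_comm]
  exact le_add_self.trans (key n)

end

/-! ### Change of measure. -/

/-- A one-sided form of the Donsker-Varadhan variational formula. -/
lemma integral_le_toReal_klDiv_add_log {Θ : Type*} [MeasurableSpace Θ] {Q P₀ : Measure Θ}
    [IsProbabilityMeasure Q] [IsProbabilityMeasure P₀] (hQ : klDiv Q P₀ ≠ ∞)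
    {g : Θ → ℝ} (hg : Integrable g Q) {G : Θ → ℝ≥0∞} (hG : Measurable G)
    (hgG : ∀ᵐ θ ∂Q, ENNReal.ofReal (Real.exp (g θ)) ≤ G θ) {c : ℝ} (hc : 0 < c)
    (hGc : ∫⁻ θ, G θ ∂P₀ ≤ ENNReal.ofReal c) :
    ∫ θ, g θ ∂Q ≤ (klDiv Q P₀).toReal + Real.log c := by
  obtain ⟨hac, hint⟩ := klDiv_ne_top_iff.1 hQ
  rw [toReal_klDiv_of_measure_eq hac (by simp)]
  have hlin : ∫⁻ θ, ENNReal.ofReal (Real.exp (g θ - llr Q P₀ θ)) ∂Q ≤ ENNReal.ofReal c := by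
    have h1 : ∀ᵐ θ ∂Q, ENNReal.ofReal (Real.exp (g θ - llr Q P₀ θ))
        ≤ (Q.rnDeriv P₀ θ)⁻¹ * G θ := by
      filter_upwards [hgG, Measure.rnDeriv_pos hac, hac (Measure.rnDeriv_lt_top Q P₀)]
        with θ h1 h2 h3
      have hp : 0 < (Q.rnDeriv P₀ θ).toReal := ENNReal.toReal_pos h2.ne' h3.ne
      rw [Real.exp_sub, llr, Real.exp_log hp, div_eq_inv_mul,
        ENNReal.ofReal_mul (by positivity), ENNReal.ofReal_inv_of_pos hp,
        ENNReal.ofReal_toReal h3.ne]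
      gcongr
    calc _ ≤ ∫⁻ θ, (Q.rnDeriv P₀ θ)⁻¹ * G θ ∂Q := lintegral_mono_ae h1
      _ = ∫⁻ θ, Q.rnDeriv P₀ θ * ((Q.rnDeriv P₀ θ)⁻¹ * G θ) ∂P₀ :=
        (lintegral_rnDeriv_mul hac ((Measure.measurable_rnDeriv Q P₀).inv.mul hG).aemeasurable).symm
      -- Only an inequality: the density may vanish on a set of positive `P₀`-measure.
      _ ≤ ∫⁻ θ, G θ ∂P₀ := lintegral_mono fun θ => by
        rw [← mul_assoc]
        exact mul_le_of_le_one_left' (ENNReal.mul_inv_le_one _)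
      _ ≤ _ := hGc
  have hd : Integrable (fun θ => g θ - llr Q P₀ θ) Q := hg.sub hint
  have hexp : Integrable (fun θ => Real.exp (g θ - llr Q P₀ θ)) Q := by
    refine (lintegral_ofReal_ne_top_iff_integrable
      (Real.continuous_exp.comp_aestronglyMeasurable hd.1)
      (ae_of_all _ fun _ => (Real.exp_pos _).le)).1 ?_
    exact (hlin.trans_lt ENNReal.ofReal_lt_top).ne
  have hle : ∫ θ, Real.exp (g θ - llr Q P₀ θ) ∂Q ≤ c := by
    rw [integral_eq_lintegral_of_nonneg_ae (ae_of_all _ fun _ => (Real.exp_pos _).le) hexp.1]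
    exact ENNReal.toReal_le_of_le_ofReal hc.le hlin
  -- The tangent to the logarithm at `c` takes the place of Jensen's inequality.
  have hpt (θ : Θ) : g θ - llr Q P₀ θ
      ≤ c⁻¹ * Real.exp (g θ - llr Q P₀ θ) + (Real.log c - 1) := by
    have := Real.add_one_le_exp (g θ - llr Q P₀ θ - Real.log c)
    rw [Real.exp_sub _ (Real.log c), Real.exp_log hc, div_eq_inv_mul] at this
    linarith
  have := integral_mono hd ((hexp.const_mul c⁻¹).add (integrable_const (Real.log c - 1))) hpt
  rw [integral_add' (hexp.const_mul c⁻¹) (integrable_const _), integral_const_mul,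
    integral_sub hg hint] at this
  have h2 : c⁻¹ * ∫ θ, Real.exp (g θ - llr Q P₀ θ) ∂Q ≤ 1 := by
    rw [inv_mul_le_iff₀ hc, mul_one]
    exact hle
  simp only [integral_const, probReal_univ, one_smul] at this
  linarith

/-! ### Likelihood ratios and their Jeffreys mixture. -/

/-- The mean over `Bernoulli x` of the likelihood ratio of `Bernoulli q` to `Bernoulli m`. -/
noncomputable def likelihoodFactor (m q x : ℝ) : ℝ≥0∞ :=
  ENNReal.ofReal x * (ENNReal.ofReal q / ENNReal.ofReal m)
    + ENNReal.ofReal (1 - x) * (ENNReal.ofReal (1 - q) / ENNReal.ofReal (1 - m))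

/-- Weighted AM-GM. An infinite `A` or `B` with positive weight makes the right side infinite; a
zero weight gives equality. -/
lemma rpow_mul_rpow_le_mul_add_mul {w : ℝ} (hw : w ∈ Set.Icc (0 : ℝ) 1) (A B : ℝ≥0∞) :
    A ^ w * B ^ (1 - w) ≤ ENNReal.ofReal w * A + ENNReal.ofReal (1 - w) * B := by
  rcases hw.1.eq_or_lt with rfl | h0
  · simp
  rcases hw.2.eq_or_lt with rfl | h1
  · simp
  have h1' : 0 < 1 - w := by linarith
  by_cases hA : A = ∞
  · simp [hA, ENNReal.mul_top, h0]
  by_cases hB : B = ∞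
  · simp [hB, ENNReal.mul_top, h1]
  lift A to NNReal using hA
  lift B to NNReal using hB
  rw [← ENNReal.coe_rpow_of_nonneg _ h0.le, ← ENNReal.coe_rpow_of_nonneg _ h1'.le]
  have := NNReal.geom_mean_le_arith_mean2_weighted w.toNNReal (1 - w).toNNReal A B
    (by rw [← Real.toNNReal_add h0.le h1'.le]; simp)
  rw [Real.coe_toNNReal _ h0.le, Real.coe_toNNReal _ h1'.le] at this
  simp only [ENNReal.ofReal]
  exact_mod_cast this

/-- AM-GM in each factor gives a bound that depends on the sample only through its sum, as for
Bernoulli data. -/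
lemma rpow_sum_mul_rpow_sum_le_prod {x : ℕ → ℝ} (hx : ∀ i, x i ∈ Set.Icc (0 : ℝ) 1) (m q : ℝ)
    (n : ℕ) :
    (ENNReal.ofReal q / ENNReal.ofReal m) ^ (∑ i ∈ Finset.range n, x i)
        * (ENNReal.ofReal (1 - q) / ENNReal.ofReal (1 - m)) ^ (∑ i ∈ Finset.range n, (1 - x i))
      ≤ ∏ i ∈ Finset.range n, likelihoodFactor m q (x i) := by
  induction n with
  | zero => simp
  | succ n ih =>
    rw [Finset.sum_range_succ, Finset.sum_range_succ, Finset.prod_range_succ,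
      ENNReal.rpow_add_of_nonneg _ _ (Finset.sum_nonneg fun i _ => (hx i).1) (hx n).1,
      ENNReal.rpow_add_of_nonneg _ _ (Finset.sum_nonneg fun i _ => sub_nonneg.2 (hx i).2)
        (sub_nonneg.2 (hx n).2), mul_mul_mul_comm]
    exact mul_le_mul' ih (rpow_mul_rpow_le_mul_add_mul (hx n) _ _)

lemma measurable_betaPDF (α β : ℝ) : Measurable (betaPDF α β) :=
  (measurable_betaPDFReal α β).ennreal_ofReal

lemma ae_mem_Ioo_betaMeasure (α β : ℝ) : ∀ᵐ q ∂betaMeasure α β, q ∈ Set.Ioo (0 : ℝ) 1 := by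
  rw [betaMeasure, ae_withDensity_iff (measurable_betaPDF α β)]
  refine ae_of_all _ fun q hq => ⟨?_, ?_⟩
  · by_contra! h
    exact hq (betaPDF_eq_zero_of_nonpos h)
  · by_contra! h
    exact hq (betaPDF_eq_zero_of_one_le h)

/-- Conjugacy: the integrand times the Beta density is a multiple of another Beta density. -/
lemma lintegral_rpow_mul_rpow_betaMeasure {α β a b : ℝ} (hα : 0 < α) (hβ : 0 < β) (ha : 0 ≤ a)
    (hb : 0 ≤ b) :
    ∫⁻ q, ENNReal.ofReal (q ^ a * (1 - q) ^ b) ∂betaMeasure α β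
      = ENNReal.ofReal (beta (a + α) (b + β) / beta α β) := by
  have h1 := beta_pos hα hβ
  have h2 : 0 < beta (a + α) (b + β) := beta_pos (by positivity) (by positivity)
  rw [betaMeasure, lintegral_withDensity_eq_lintegral_mul _
    (measurable_betaPDF α β) (by fun_prop)]
  have : ∀ q, (betaPDF α β * fun q => ENNReal.ofReal (q ^ a * (1 - q) ^ b)) q
      = ENNReal.ofReal (beta (a + α) (b + β) / beta α β) * betaPDF (a + α) (b + β) q := by
    intro q
    rcases le_or_gt q 0 with h | h
    · simp [betaPDF_eq_zero_of_nonpos h]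
    rcases le_or_gt 1 q with h' | h'
    · simp [betaPDF_eq_zero_of_one_le h']
    have hq : 0 < 1 - q := by linarith
    rw [Pi.mul_apply, betaPDF_of_pos_lt_one h h', betaPDF_of_pos_lt_one h h',
      ← ENNReal.ofReal_mul (by positivity), ← ENNReal.ofReal_mul (by positivity)]
    congr 1
    rw [add_sub_assoc, add_sub_assoc, Real.rpow_add h, Real.rpow_add hq]
    field_simp
  simp_rw [this]
  rw [lintegral_const_mul _ (measurable_betaPDF _ _),
    lintegral_betaPDF_eq_one (by positivity) (by positivity), mul_one]

/-- Here and below, `0 < a → 0 < m` expresses absolute continuity; for `a = 0` both powers are `1`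
whatever `m` is. -/
lemma ofReal_div_rpow {q m a : ℝ} (hq : 0 ≤ q) (ha : 0 ≤ a) (hm : 0 < a → 0 < m) :
    (ENNReal.ofReal q / ENNReal.ofReal m) ^ a = ENNReal.ofReal ((q / m) ^ a) := by
  rcases ha.eq_or_lt with rfl | h
  · simp
  rw [← ENNReal.ofReal_div_of_pos (hm h),
    ENNReal.ofReal_rpow_of_nonneg (div_nonneg hq (hm h).le) ha]

lemma mul_log_div_div {a c m : ℝ} (hc : 0 < c) (ha : 0 ≤ a) (hm : 0 < a → 0 < m) :
    a * Real.log (a / c / m) = a * Real.log a - a * Real.log c - a * Real.log m := by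
  rcases ha.eq_or_lt with rfl | h
  · simp
  have := hm h
  rw [Real.log_div (by positivity) (by positivity), Real.log_div (by positivity) (by positivity)]
  ring

lemma log_rpow_of_nonneg {m a : ℝ} (ha : 0 ≤ a) (hm : 0 < a → 0 < m) :
    0 < m ^ a ∧ Real.log (m ^ a) = a * Real.log m := by
  rcases ha.eq_or_lt with rfl | h
  · simp
  exact ⟨Real.rpow_pos_of_pos (hm h) _, Real.log_rpow (hm h) _⟩

/-- The mixture of likelihood ratios under the Jeffreys prior is infinite when the Bernoulli
divergence is. -/
lemma pos_of_lintegral_rpow_ne_top {m m' a b : ℝ} (ha : 0 < a) (hb : 0 ≤ b)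
    (h : ∫⁻ q, (ENNReal.ofReal q / ENNReal.ofReal m) ^ a
      * (ENNReal.ofReal (1 - q) / ENNReal.ofReal m') ^ b ∂betaMeasure (1 / 2) (1 / 2) ≠ ∞) :
    0 < m := by
  by_contra! hm
  have : IsProbabilityMeasure (betaMeasure (1 / 2) (1 / 2)) :=
    isProbabilityMeasureBeta (by norm_num) (by norm_num)
  refine h ?_
  rw [lintegral_congr_ae (g := fun _ => ∞), lintegral_const, measure_univ, mul_one]
  filter_upwards [ae_mem_Ioo_betaMeasure (1 / 2) (1 / 2)] with q hq
  rw [ENNReal.ofReal_of_nonpos hm, ENNReal.div_zero (by simpa using hq.1),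
    ENNReal.top_rpow_of_pos ha]
  refine ENNReal.top_mul ?_
  -- The other factor must be nonzero, lest the product be `∞ * 0 = 0`.
  have h1 : ENNReal.ofReal (1 - q) / ENNReal.ofReal m' ≠ 0 := by
    simp [ENNReal.div_eq_zero_iff, hq.2]
  rw [Ne, ENNReal.rpow_eq_zero_iff]
  rintro (⟨h, -⟩ | ⟨-, h⟩)
  · exact h1 h
  · exact h.not_ge hb

lemma pos_of_lintegral_rpow_ne_top' {m m' a b : ℝ} (ha : 0 ≤ a) (hb : 0 < b)
    (h : ∫⁻ q, (ENNReal.ofReal q / ENNReal.ofReal m) ^ a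
      * (ENNReal.ofReal (1 - q) / ENNReal.ofReal m') ^ b ∂betaMeasure (1 / 2) (1 / 2) ≠ ∞) :
    0 < m' := by
  by_contra! hm
  have : IsProbabilityMeasure (betaMeasure (1 / 2) (1 / 2)) :=
    isProbabilityMeasureBeta (by norm_num) (by norm_num)
  refine h ?_
  rw [lintegral_congr_ae (g := fun _ => ∞), lintegral_const, measure_univ, mul_one]
  filter_upwards [ae_mem_Ioo_betaMeasure (1 / 2) (1 / 2)] with q hq
  rw [ENNReal.ofReal_of_nonpos hm, ENNReal.div_zero (by simpa using hq.2),
    ENNReal.top_rpow_of_pos hb]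
  refine ENNReal.mul_top ?_
  have h1 : ENNReal.ofReal q / ENNReal.ofReal m ≠ 0 := by
    simp [ENNReal.div_eq_zero_iff, hq.1]
  rw [Ne, ENNReal.rpow_eq_zero_iff]
  rintro (⟨h, -⟩ | ⟨-, h⟩)
  · exact h1 h
  · exact h.not_ge ha

/-- The regret bound of the Krichevsky-Trofimov mixture. -/
lemma ofReal_exp_le_lintegral_rpow {m m' a b : ℝ} (ha : 0 ≤ a) (hb : 0 ≤ b) (hab : 0 < a + b)
    (hm : 0 < a → 0 < m) (hm' : 0 < b → 0 < m') :
    ENNReal.ofReal (Real.exp (a * Real.log (a / (a + b) / m) + b * Real.log (b / (a + b) / m')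
        - Real.log (√Real.pi * Real.Gamma (a + b + 1) / Real.Gamma (a + b + 1 / 2))))
      ≤ ∫⁻ q, (ENNReal.ofReal q / ENNReal.ofReal m) ^ a
        * (ENNReal.ofReal (1 - q) / ENNReal.ofReal m') ^ b ∂betaMeasure (1 / 2) (1 / 2) := by
  obtain ⟨p1, l1⟩ := log_rpow_of_nonneg ha hm
  obtain ⟨p2, l2⟩ := log_rpow_of_nonneg hb hm'
  have hβ : 0 < beta (1 / 2) (1 / 2) := beta_pos (by norm_num) (by norm_num)
  have hβ' : 0 < beta (a + 1 / 2) (b + 1 / 2) := beta_pos (by positivity) (by positivity)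
  have hint : ∫⁻ q, (ENNReal.ofReal q / ENNReal.ofReal m) ^ a
        * (ENNReal.ofReal (1 - q) / ENNReal.ofReal m') ^ b ∂betaMeasure (1 / 2) (1 / 2)
      = ENNReal.ofReal (beta (a + 1 / 2) (b + 1 / 2) / beta (1 / 2) (1 / 2)
          * (m ^ a * m' ^ b)⁻¹) := by
    rw [ENNReal.ofReal_mul (by positivity), ← lintegral_rpow_mul_rpow_betaMeasure (by norm_num)
      (by norm_num) ha hb, ← lintegral_mul_const _ (by fun_prop)]
    refine lintegral_congr_ae ?_
    filter_upwards [ae_mem_Ioo_betaMeasure (1 / 2) (1 / 2)] with q hq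
    have hq0 := hq.1
    have hq1 : 0 < 1 - q := by linarith [hq.2]
    have n1 : 0 ≤ (q / m) ^ a := by
      rcases ha.eq_or_lt with rfl | h
      · simp
      · exact Real.rpow_nonneg (div_nonneg hq0.le (hm h).le) _
    have e (q m a : ℝ) (hq : 0 < q) (ha : 0 ≤ a) (hm : 0 < a → 0 < m) :
        (q / m) ^ a = q ^ a / m ^ a := by
      rcases ha.eq_or_lt with rfl | h
      · simp
      · exact Real.div_rpow hq.le (hm h).le _
    rw [ofReal_div_rpow hq0.le ha hm, ofReal_div_rpow hq1.le hb hm', ← ENNReal.ofReal_mul n1,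
      ← ENNReal.ofReal_mul (by positivity), e q m a hq0 ha hm, e _ m' b hq1 hb hm']
    congr 1
    field_simp
  rw [hint]
  refine ENNReal.ofReal_le_ofReal ?_
  rw [← Real.le_log_iff_exp_le (by positivity)]
  have g0 : 0 < Real.Gamma (1 / 2) := Real.Gamma_pos_of_pos (by norm_num)
  have g1 : 0 < Real.Gamma (a + 1 / 2) := Real.Gamma_pos_of_pos (by positivity)
  have g2 : 0 < Real.Gamma (b + 1 / 2) := Real.Gamma_pos_of_pos (by positivity)
  have g3 : 0 < Real.Gamma (a + b + 1) := Real.Gamma_pos_of_pos (by positivity)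
  have g4 : 0 < Real.Gamma (a + b + 1 / 2) := Real.Gamma_pos_of_pos (by positivity)
  have hb1 : beta (1 / 2) (1 / 2) = Real.Gamma (1 / 2) * Real.Gamma (1 / 2) := by
    rw [beta]; norm_num
  have hb2 : beta (a + 1 / 2) (b + 1 / 2)
      = Real.Gamma (a + 1 / 2) * Real.Gamma (b + 1 / 2) / Real.Gamma (a + b + 1) := by
    rw [beta]; congr 2; ring
  -- The terms in `m`, `m'` and `Γ(a + b + 1)` cancel, and `√π` cancels one of the two factors
  -- `Γ(1/2)` of `beta (1/2) (1/2)`; what remains is exactly `key`.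
  have key := log_Gamma_half_add_le ha hb
  rw [mul_log_div_div hab ha hm, mul_log_div_div hab hb hm', ← Real.Gamma_one_half_eq,
    Real.log_div (by positivity) (by positivity), Real.log_mul (by positivity) (by positivity),
    Real.log_mul (by positivity) (by positivity), Real.log_inv,
    Real.log_mul (by positivity) (by positivity), l1, l2,
    Real.log_div (by positivity) (by positivity), hb1, hb2,
    Real.log_div (by positivity) (by positivity), Real.log_mul (by positivity) (by positivity),
    Real.log_mul (by positivity) (by positivity)]
  linarith

/-! ### Passing to posterior means by joint convexity. -/

/-- The tangent plane of `(x, y) ↦ x log (x / y)` at `(p, q)` lies below its graph. -/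
lemma mul_log_div_add_sub_le {x y p q : ℝ} (hx : 0 ≤ x) (hy : 0 ≤ y) (hp : 0 ≤ p) (hq : 0 ≤ q)
    (hxy : 0 < x → 0 < y) (hpq : 0 < p → 0 < q) (hpx : p = 0 → x = 0) :
    x * Real.log (p / q) + x - y * (p / q) ≤ x * Real.log (x / y) := by
  rcases hx.eq_or_lt with rfl | hx
  · simp only [zero_mul, zero_add, zero_sub]
    exact neg_nonpos.2 (by positivity)
  have hp' : 0 < p := lt_of_le_of_ne hp fun h => hx.ne' (hpx h.symm)
  have hq' := hpq hp'
  have hy' := hxy hx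
  have h := Real.log_le_sub_one_of_pos (show 0 < (p / q) / (x / y) by positivity)
  rw [Real.log_div (by positivity) (by positivity)] at h
  have h2 := mul_le_mul_of_nonneg_left h hx.le
  have e : x * (p / q / (x / y) - 1) = y * (p / q) - x := by field_simp
  rw [e] at h2
  linarith

lemma klTerm_eq_coe {p q : ℝ} (h : p ≠ 0 → q ≠ 0) :
    klTerm p q = ((p * Real.log (p / q) : ℝ) : EReal) := by
  by_cases hp : p = 0
  · simp [klTerm, hp]
  · simp [klTerm, hp, h hp]

section

variable {Θ : Type*} [MeasurableSpace Θ] {Q : Measure Θ}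

/-- Absolute continuity survives averaging, so the divergence at the means has no infinite term. -/
lemma integral_pos_of_ae_pos_imp_pos {u v : Θ → ℝ} (hu : ∀ θ, 0 ≤ u θ)
    (hv : ∀ θ, 0 ≤ v θ) (hvi : Integrable v Q)
    (huv : ∀ᵐ θ ∂Q, 0 < u θ → 0 < v θ) (h : 0 < ∫ θ, u θ ∂Q) : 0 < ∫ θ, v θ ∂Q := by
  refine lt_of_le_of_ne (integral_nonneg hv) fun h0 => h.ne' ?_
  have := (integral_eq_zero_iff_of_nonneg hv hvi).1 h0.symm
  refine integral_eq_zero_of_ae ?_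
  filter_upwards [this, huv] with θ h1 h2
  by_contra h3
  have := h2 (lt_of_le_of_ne (hu θ) (Ne.symm h3))
  exact this.ne' h1

/-- A linear lower bound of `x log (x / y)` whose integral is the value at the means. -/
lemma exists_integrable_le_mul_log_div {u v : Θ → ℝ} (hu : ∀ θ, 0 ≤ u θ) (hv : ∀ θ, 0 ≤ v θ)
    (hui : Integrable u Q) (hvi : Integrable v Q)
    (huv : ∀ᵐ θ ∂Q, 0 < u θ → 0 < v θ) :
    ∃ t : Θ → ℝ, Integrable t Q ∧ (∀ᵐ θ ∂Q, t θ ≤ u θ * Real.log (u θ / v θ)) ∧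
      ∫ θ, t θ ∂Q = (∫ θ, u θ ∂Q) * Real.log ((∫ θ, u θ ∂Q) / ∫ θ, v θ ∂Q) := by
  set p := ∫ θ, u θ ∂Q with hp
  set q := ∫ θ, v θ ∂Q with hq
  have hpq : 0 < p → 0 < q := integral_pos_of_ae_pos_imp_pos hu hv hvi huv
  have hp0 : 0 ≤ p := integral_nonneg hu
  have hq0 : 0 ≤ q := integral_nonneg hv
  have hsum : Integrable (fun θ => u θ * Real.log (p / q) + u θ) Q := (hui.mul_const _).add hui
  -- The tangent plane at the means is affine in `u` and `v`, hence integrable, which `u log (u /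
  -- v)` is not known to be; the correction `p - q (p / q)` vanishes on integration.
  refine ⟨fun θ => u θ * Real.log (p / q) + u θ - v θ * (p / q),
    hsum.sub (hvi.mul_const _), ?_, ?_⟩
  · have hpx : ∀ᵐ θ ∂Q, p = 0 → u θ = 0 := by
      by_cases h : p = 0
      · filter_upwards [(integral_eq_zero_iff_of_nonneg hu hui).1 h] with θ hθ _
        exact hθ
      · exact ae_of_all _ fun θ h' => absurd h' h
    filter_upwards [huv, hpx] with θ h1 h2
    exact mul_log_div_add_sub_le (hu θ) (hv θ) hp0 hq0 h1 hpq h2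
  · rw [integral_sub hsum (hvi.mul_const _),
      integral_add (hui.mul_const _) hui, integral_mul_const, integral_mul_const, ← hp, ← hq]
    rcases hp0.eq_or_lt with h | h
    · simp [← h]
    · have := (hpq h).ne'
      field_simp
      ring

/-- The change of measure step. -/
lemma bernoulliKL_integral_le [IsProbabilityMeasure Q] {P₀ : Measure Θ}
    [IsProbabilityMeasure P₀] {n : ℕ} (hn : 1 ≤ n)
    {u v : Θ → ℝ} (hum : Measurable u) (hvm : Measurable v)
    (hu : ∀ θ, u θ ∈ Set.Icc (0 : ℝ) 1) (hv : ∀ θ, v θ ∈ Set.Icc (0 : ℝ) 1)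
    {G : Θ → ℝ≥0∞} (hG : Measurable G) {c r : ℝ} (hc : 0 < c)
    (hGc : ∫⁻ θ, G θ ∂P₀ ≤ ENNReal.ofReal c)
    (hGu : ∀ θ, G θ ≠ ∞ → (0 < u θ → 0 < v θ) ∧ (0 < 1 - u θ → 0 < 1 - v θ) ∧
      ENNReal.ofReal (Real.exp (n * (u θ * Real.log (u θ / v θ)
        + (1 - u θ) * Real.log ((1 - u θ) / (1 - v θ))) - r)) ≤ G θ) :
    bernoulliKL (∫ θ, u θ ∂Q) (∫ θ, v θ ∂Q)
      ≤ ((klDiv Q P₀ : EReal) + (r : EReal) + ((Real.log c : ℝ) : EReal)) / (n : EReal) := by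
  have hn0 : (0 : ℝ) < n := by exact_mod_cast hn
  by_cases hQ : klDiv Q P₀ = ∞
  · rw [hQ, EReal.coe_ennreal_top, EReal.top_add_coe, EReal.top_add_coe,
      EReal.top_div_of_pos_ne_top (by exact_mod_cast hn) (EReal.natCast_ne_top n)]
    exact le_top
  have hac := (klDiv_ne_top_iff.1 hQ).1
  -- Finiteness holds `P₀`-almost everywhere by the bound on the integral, and transfers to `Q` by
  -- absolute continuity.
  have hfin : ∀ᵐ θ ∂Q, G θ ≠ ∞ := hac <| by
    filter_upwards [ae_lt_top hG (hGc.trans_lt ENNReal.ofReal_lt_top).ne] with θ h using h.ne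
  have int (w : Θ → ℝ) (hwm : Measurable w) (hw : ∀ θ, w θ ∈ Set.Icc (0 : ℝ) 1) :
      Integrable w Q :=
    Integrable.of_mem_Icc 0 1 hwm.aemeasurable (ae_of_all _ hw)
  have hui := int u hum hu
  have hvi := int v hvm hv
  have hui' : Integrable (fun θ => 1 - u θ) Q := (integrable_const 1).sub hui
  have hvi' : Integrable (fun θ => 1 - v θ) Q := (integrable_const 1).sub hvi
  have huv : ∀ᵐ θ ∂Q, 0 < u θ → 0 < v θ := by
    filter_upwards [hfin] with θ h using (hGu θ h).1
  have huv' : ∀ᵐ θ ∂Q, 0 < 1 - u θ → 0 < 1 - v θ := by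
    filter_upwards [hfin] with θ h using (hGu θ h).2.1
  have hu0 (θ : Θ) : 0 ≤ u θ := (hu θ).1
  have hv0 (θ : Θ) : 0 ≤ v θ := (hv θ).1
  have hu1 (θ : Θ) : 0 ≤ 1 - u θ := sub_nonneg.2 (hu θ).2
  have hv1 (θ : Θ) : 0 ≤ 1 - v θ := sub_nonneg.2 (hv θ).2
  obtain ⟨t, hti, htle, ht⟩ := exists_integrable_le_mul_log_div hu0 hv0 hui hvi huv
  obtain ⟨t', hti', htle', ht'⟩ := exists_integrable_le_mul_log_div hu1 hv1 hui' hvi' huv'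
  have hpos := integral_pos_of_ae_pos_imp_pos hu0 hv0 hvi huv
  have hpos' := integral_pos_of_ae_pos_imp_pos hu1 hv1 hvi' huv'
  have hp0 : 0 ≤ ∫ θ, u θ ∂Q := integral_nonneg hu0
  have hp1 : 0 ≤ ∫ θ, 1 - u θ ∂Q := integral_nonneg hu1
  have eu : ∫ θ, 1 - u θ ∂Q = 1 - ∫ θ, u θ ∂Q := by
    rw [integral_sub (integrable_const 1) hui]; simp
  have ev : ∫ θ, 1 - v θ ∂Q = 1 - ∫ θ, v θ ∂Q := by
    rw [integral_sub (integrable_const 1) hvi]; simp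
  rw [eu, ev] at ht' hpos'
  rw [eu] at hp1
  have hti2 : Integrable (fun θ => n * (t θ + t' θ)) Q := (hti.add hti').const_mul _
  have main := integral_le_toReal_klDiv_add_log hQ (g := fun θ => n * (t θ + t' θ) - r)
    (hti2.sub (integrable_const r)) hG (by
      filter_upwards [hfin, htle, htle'] with θ h h1 h2
      refine le_trans ?_ (hGu θ h).2.2
      gcongr) hc hGc
  rw [integral_sub hti2 (integrable_const r), integral_const_mul, integral_add hti hti', ht, ht']
    at main
  simp only [integral_const, probReal_univ, one_smul] at main
  rw [bernoulliKL, klTerm_eq_coe fun h => (hpos (lt_of_le_of_ne hp0 h.symm)).ne',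
    klTerm_eq_coe fun h => (hpos' (lt_of_le_of_ne hp1 h.symm)).ne',
    ← EReal.coe_ennreal_toReal hQ, ← EReal.coe_natCast, ← EReal.coe_add, ← EReal.coe_add,
    ← EReal.coe_add, ← EReal.coe_div, EReal.coe_le_coe_iff, le_div_iff₀ hn0]
  linarith

end

/-! ### Application to the sample. -/

section

variable {Ω 𝒳 Θ : Type*} [MeasurableSpace Ω] [MeasurableSpace 𝒳] [MeasurableSpace Θ]

lemma measurable_likelihoodFactor :
    Measurable fun z : ℝ × ℝ × ℝ => likelihoodFactor z.1 z.2.1 z.2.2 := by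
  unfold likelihoodFactor
  fun_prop

lemma measurable_trueMean {P : Measure Ω} [SFinite P] {f : Θ → 𝒳 → ℝ}
    (hf : Measurable (Function.uncurry f)) {Y : Ω → 𝒳} (hY : Measurable Y) :
    Measurable (trueMean f P Y) := by
  have h : Measurable fun z : Θ × Ω => f z.1 (Y z.2) :=
    hf.comp (measurable_fst.prodMk (hY.comp measurable_snd))
  exact h.stronglyMeasurable.integral_prod_right.measurable

lemma integral_mem_Icc_zero_one {P : Measure Ω} [IsProbabilityMeasure P] {Z : Ω → ℝ}
    (hZm : Measurable Z) (hZ : ∀ ω, Z ω ∈ Set.Icc (0 : ℝ) 1) :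
    ∫ ω, Z ω ∂P ∈ Set.Icc (0 : ℝ) 1 := by
  refine ⟨integral_nonneg fun ω => (hZ ω).1, ?_⟩
  have := integral_mono (Integrable.of_mem_Icc 0 1 hZm.aemeasurable (ae_of_all P hZ))
    (integrable_const (1 : ℝ)) fun ω => (hZ ω).2
  simpa using this

/-- The two terms integrate to `q` and `1 - q`, except that a term vanishes when its denominator
does, since `0 * ∞ = 0`. -/
lemma lintegral_likelihoodFactor_le_one {P : Measure Ω} [IsProbabilityMeasure P] {Z : Ω → ℝ}
    (hZm : Measurable Z) (hZ : ∀ ω, Z ω ∈ Set.Icc (0 : ℝ) 1) {q : ℝ}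
    (hq : q ∈ Set.Icc (0 : ℝ) 1) :
    ∫⁻ ω, likelihoodFactor (∫ ω, Z ω ∂P) q (Z ω) ∂P ≤ 1 := by
  have hZi : Integrable Z P := Integrable.of_mem_Icc 0 1 hZm.aemeasurable (ae_of_all _ hZ)
  have hZi' : Integrable (fun ω => 1 - Z ω) P := (integrable_const 1).sub hZi
  unfold likelihoodFactor
  rw [lintegral_add_left (by fun_prop), lintegral_mul_const _ (by fun_prop),
    lintegral_mul_const _ (by fun_prop),
    ← ofReal_integral_eq_lintegral_ofReal hZi (ae_of_all _ fun ω => (hZ ω).1),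
    ← ofReal_integral_eq_lintegral_ofReal hZi'
      (ae_of_all _ fun ω => sub_nonneg.2 (hZ ω).2), integral_sub (integrable_const 1) hZi]
  simp only [integral_const, probReal_univ, one_smul]
  calc _ ≤ ENNReal.ofReal q + ENNReal.ofReal (1 - q) :=
        add_le_add ENNReal.mul_div_le ENNReal.mul_div_le
    _ = 1 := by
        rw [← ENNReal.ofReal_add hq.1 (sub_nonneg.2 hq.2)]
        simp

/-- The mixture of likelihood ratios dominates the exponential of the Bernoulli divergence. -/
lemma ofReal_exp_le_lintegral_prod {n : ℕ} (hn : 1 ≤ n) {x : ℕ → ℝ}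
    (hx : ∀ i, x i ∈ Set.Icc (0 : ℝ) 1) {u m : ℝ} (hu : u = (∑ i ∈ Finset.range n, x i) / n)
    (h : ∫⁻ q, ∏ i ∈ Finset.range n, likelihoodFactor m q (x i) ∂betaMeasure (1 / 2) (1 / 2)
      ≠ ∞) :
    (0 < u → 0 < m) ∧ (0 < 1 - u → 0 < 1 - m) ∧
      ENNReal.ofReal (Real.exp (n * (u * Real.log (u / m)
        + (1 - u) * Real.log ((1 - u) / (1 - m)))
        - Real.log (√Real.pi * Real.Gamma ((n : ℝ) + 1) / Real.Gamma ((n : ℝ) + 1 / 2))))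
      ≤ ∫⁻ q, ∏ i ∈ Finset.range n, likelihoodFactor m q (x i) ∂betaMeasure (1 / 2) (1 / 2) := by
  have hn0 : (0 : ℝ) < n := by exact_mod_cast hn
  have hle := lintegral_mono (μ := betaMeasure (1 / 2) (1 / 2))
    fun q => rpow_sum_mul_rpow_sum_le_prod hx m q n
  have ha : 0 ≤ ∑ i ∈ Finset.range n, x i := Finset.sum_nonneg fun i _ => (hx i).1
  have hb : 0 ≤ ∑ i ∈ Finset.range n, (1 - x i) :=
    Finset.sum_nonneg fun i _ => sub_nonneg.2 (hx i).2
  have hab : ∑ i ∈ Finset.range n, x i + ∑ i ∈ Finset.range n, (1 - x i) = n := by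
    rw [← Finset.sum_add_distrib]; simp
  set a := ∑ i ∈ Finset.range n, x i
  set b := ∑ i ∈ Finset.range n, (1 - x i)
  have hu' : 1 - u = b / n := by
    rw [hu, eq_div_iff hn0.ne']
    field_simp
    linarith
  have htop := (hle.trans_lt h.lt_top).ne
  have hm (h : 0 < a) : 0 < m := pos_of_lintegral_rpow_ne_top h hb htop
  have hm' (h : 0 < b) : 0 < 1 - m := pos_of_lintegral_rpow_ne_top' ha h htop
  refine ⟨fun h => hm ?_, fun h => hm' ?_, le_trans (le_of_eq ?_)
    ((ofReal_exp_le_lintegral_rpow ha hb (by rw [hab]; exact hn0) hm hm').trans hle)⟩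
  · rw [hu] at h
    exact (div_pos_iff_of_pos_right hn0).1 h
  · rw [hu'] at h
    exact (div_pos_iff_of_pos_right hn0).1 h
  · rw [hab, hu', hu]
    congr 3
    field_simp

end

end PACBayes

/-! ### The PAC-Bayes bound. -/

open PACBayes in
theorem proposition2 {Ω 𝒳 Θ : Type*} [MeasurableSpace Ω] [MeasurableSpace 𝒳] [MeasurableSpace Θ]
    (P : Measure Ω) [IsProbabilityMeasure P]
    (X : ℕ → Ω → 𝒳) (hX : ∀ i, Measurable (X i)) (hindep : iIndepFun X P)
    (hident : ∀ i, IdentDistrib (X i) (X 0) P P)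
    (f : Θ → 𝒳 → ℝ) (hf : Measurable (Function.uncurry f))
    (hf01 : ∀ θ x, f θ x ∈ Set.Icc (0 : ℝ) 1)
    (P₀ : Measure Θ) [IsProbabilityMeasure P₀]
    (δ : ℝ) (hδ : δ ∈ Set.Ioc (0 : ℝ) 1) :
    ∃ E : Set Ω, MeasurableSet E ∧ 1 - δ ≤ P.real E ∧
      ∀ ω ∈ E, ∀ n : ℕ, 1 ≤ n →
        ∀ κ : Kernel (Fin n → 𝒳) Θ, IsMarkovKernel κ →
          PACBayes.bernoulliKL
              (∫ θ, PACBayes.empiricalMean f (fun i : Fin n => X i ω) θ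
                ∂(κ fun i : Fin n => X i ω))
              (∫ θ, PACBayes.trueMean f P (X 0) θ ∂(κ fun i : Fin n => X i ω)) ≤
            (PACBayes.complexity n (κ fun i : Fin n => X i ω) P₀ +
              ((Real.log (1 / δ) : ℝ) : EReal)) / (n : EReal) := by
  have hβ : IsProbabilityMeasure (betaMeasure (1 / 2) (1 / 2)) :=
    isProbabilityMeasureBeta (by norm_num) (by norm_num)
  have hfθ (θ : Θ) : Measurable (f θ) := hf.comp measurable_prodMk_left
  have hμ : Measurable (trueMean f P (X 0)) := measurable_trueMean hf (hX 0)
  have hμ01 (θ : Θ) : trueMean f P (X 0) θ ∈ Set.Icc (0 : ℝ) 1 :=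
    integral_mem_Icc_zero_one ((hfθ θ).comp (hX 0)) fun ω => hf01 θ _
  let L : Θ × ℝ → 𝒳 → ENNReal := fun s x =>
    likelihoodFactor (trueMean f P (X 0) s.1) s.2 (f s.1 x)
  have hL : Measurable (Function.uncurry L) :=
    measurable_likelihoodFactor.comp
      ((hμ.comp (measurable_fst.comp measurable_fst)).prodMk
        ((measurable_snd.comp measurable_fst).prodMk
          (hf.comp ((measurable_fst.comp measurable_fst).prodMk measurable_snd))))
  let ρ := P₀.prod (betaMeasure (1 / 2) (1 / 2))
  have hL1 : ∀ᵐ s ∂ρ, ∀ i, ∫⁻ ω, L s (X i ω) ∂P ≤ 1 := by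
    have hs : ∀ᵐ s ∂ρ, s.2 ∈ Set.Ioo (0 : ℝ) 1 :=
      Measure.quasiMeasurePreserving_snd.ae (ae_mem_Ioo_betaMeasure (1 / 2) (1 / 2))
    filter_upwards [hs] with s hs i
    have hid := (hident i).comp (hfθ s.1)
    have e : trueMean f P (X 0) s.1 = ∫ ω, f s.1 (X i ω) ∂P := hid.integral_eq.symm
    simp only [L, e]
    exact lintegral_likelihoodFactor_le_one ((hfθ s.1).comp (hX i)) (fun ω => hf01 s.1 _)
      ⟨hs.1.le, hs.2.le⟩
  have hM (n : ℕ) : Measurable fun ω => mixture ρ L n (fun i => X i ω) :=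
    (measurable_mixture ρ hL n).comp (measurable_pi_lambda _ hX)
  have hδ' : 0 < 1 / δ := one_div_pos.2 hδ.1
  -- The exceptional event is fixed before `n` and `κ`, which makes the bound simultaneous.
  let A : Set Ω := {ω | ∃ n, ENNReal.ofReal (1 / δ) ≤ mixture ρ L n (fun i => X i ω)}
  have hA : MeasurableSet A := by
    have : A = ⋃ n, {ω | ENNReal.ofReal (1 / δ) ≤ mixture ρ L n (fun i => X i ω)} := by
      ext; simp [A]
    rw [this]
    exact MeasurableSet.iUnion fun n => measurableSet_le measurable_const (hM n)
  refine ⟨Aᶜ, hA.compl, ?_, ?_⟩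
  · rw [probReal_compl_eq_one_sub hA]
    have h : P A ≤ (ENNReal.ofReal (1 / δ))⁻¹ :=
      measure_exists_le_mixture_le hX hindep ρ hL hL1 _
    rw [← ENNReal.ofReal_inv_of_pos hδ', inv_div, div_one] at h
    have : P.real A ≤ δ := ENNReal.toReal_le_of_le_ofReal hδ.1.le h
    linarith
  · intro ω hω n hn κ _
    have hprod : Measurable fun s : Θ × ℝ => ∏ i ∈ Finset.range n, L s (X i ω) :=
      Finset.measurable_prod _ fun i _ => hL.comp (measurable_id.prodMk measurable_const)
    have hlt : ∫⁻ θ, ∫⁻ q, ∏ i ∈ Finset.range n, L (θ, q) (X i ω) ∂betaMeasure (1 / 2) (1 / 2) ∂P₀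
        ≤ ENNReal.ofReal (1 / δ) := by
      rw [← lintegral_prod _ hprod.aemeasurable]
      by_contra! h
      exact hω ⟨n, h.le⟩
    have hemp (θ : Θ) : empiricalMean f (fun i : Fin n => X i ω) θ
        = (∑ i ∈ Finset.range n, f θ (X i ω)) / n := by
      rw [empiricalMean, Fin.sum_univ_eq_sum_range fun i => f θ (X i ω)]
    have hn0 : (0 : ℝ) < n := by exact_mod_cast hn
    -- Here `G θ` is the mixture over `q` alone, `r` the logarithmic Gamma term of the complexity,
    -- and `c = 1 / δ`.
    refine bernoulliKL_integral_le hn ?_ hμ ?_ hμ01 hprod.lintegral_prod_right' hδ' hlt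
      fun θ h => ofReal_exp_le_lintegral_prod hn (fun i => hf01 θ (X i ω)) (hemp θ) h
    · simp only [funext hemp]
      exact (Finset.measurable_sum _ fun i _ =>
        hf.comp (measurable_id.prodMk measurable_const)).div_const _
    · intro θ
      rw [hemp]
      refine ⟨div_nonneg (Finset.sum_nonneg fun i _ => (hf01 θ _).1) hn0.le, ?_⟩
      rw [div_le_one hn0]
      simpa using Finset.sum_le_sum fun i (_ : i ∈ Finset.range n) => (hf01 θ (X i ω)).2
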